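/- Let $G$ be an affine algebraic group over $\mathbb{C}$ (for example a reductive group; neither connectedness nor reductivity is needed), with Hopf algebra $\mathcal{O}(G)$ of regular functions, and let $V$ be a finite-dimensional algebraic representation of $G$. Let $\mathcal{O}(G)^*$ be the space of algebraic distributions on $G$, i.e. the linear dual of $\mathcal{O}(G)$; it is an algebra under convolution and an $\mathcal{O}(G)$-module by $(f\mu,h)=(\mu,fh)$. Let $\kappa:V\times V\to\mathcal{O}(G)^*$ be a skew-symmetric $G$-equivariant $\mathbb{C}$-bilinear pairing, where $G$ acts on $\mathcal{O}(G)^*$ by conjugation. Let $TV\rtimes\mathcal{O}(G)^*$ be the algebra generated by $V$ and the algebra $\mathcal{O}(G)^*$ with the relations $\mu\cdot x=\sum_i v_i\cdot(v_i^*,gx)\mu$ for $x\in V$, $\mu\in\mathcal{O}(G)^*$, where $(v_i)$ is a basis of $V$ with dual basis $(v_i^*)$ and $(v_i^*,gx)$ is regarded as a regular function of $g\in G$. Let $\mathsf{H}_\kappa$ be its quotient by the relations $xy-yx=\kappa(x,y)$ for $x,y\in V$, filtered by $\deg x=1$ for $x\in V$ and $\deg\mu=0$ for $\mu\in\mathcal{O}(G)^*$.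 One says that $\mathsf{H}_\kappa$ has the PBW property if the natural algebra homomorphism $\mathsf{H}_0=SV\rtimes\mathcal{O}(G)^*\to\operatorname{gr}(\mathsf{H}_\kappa)$, which sends $x\in V$ to its class in degree $1$ and $\mu\in\mathcal{O}(G)^*$ to its class in degree $0$, is an isomorphism. Let $\Phi\subset G$ be the closed subscheme defined by the equation $\wedge^3(1-g|_V)=0$, that is, the one whose ideal $I(\Phi)\subset\mathcal{O}(G)$ is generated by the matrix coefficients of $\wedge^3(1-g|_V)$, and let $S$ be the set of the elements $g\in G$ such that $\operatorname{rank}(1-g|_V)\le 2$. **Proposition.** If $\mathsf{H}_\kappa$ has the PBW property, then for all $x,y\in V$ the distribution $\kappa(x,y)$ is supported on the scheme $\Phi$, i.e. it annihilates $I(\Phi)$. In particular, $\kappa(x,y)$ is set-theoretically supported on $S$, i.e. it annihilates some power of the ideal of the regular functions that vanish on $S$. -/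

import Mathlib

open scoped TensorProduct DirectSum

noncomputable section

namespace ContHecke

universe u v

/-! ### The associated graded algebra of a filtered algebra -/

section AssociatedGraded

variable {R : Type u} [Ring R] [Algebra ℂ R] (F Flt : ℕ → Submodule ℂ R)

/-- The degree `n` piece `F n / F_{<n}` of the associated graded algebra. -/
abbrev GrPiece (n : ℕ) : Type u := F n ⧸ (Flt n).submoduleOf (F n)

/-- The class in `F n / F_{<n}` of an element of `F n`. -/
abbrev grClass (n : ℕ) : F n →ₗ[ℂ] GrPiece F Flt n := ((Flt n).submoduleOf (F n)).mkQ

variable {F Flt}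

theorem mul_mem_lt_left [IsRingFiltration F Flt] {i j : ℕ} {a b : R}
    (ha : a ∈ Flt i) (hb : b ∈ F j) : a * b ∈ Flt (i + j) := by
  have h : Flt i ≤ (Flt (i + j)).comap (LinearMap.mulRight ℂ b) := by
    refine IsFiltration.is_sup (F := F) _ i fun m hm c hc => ?_
    exact IsFiltration.is_le (F := F) (by omega : m + j < i + j)
      (SetLike.GradedMul.mul_mem hc hb)
  exact h ha

theorem mul_mem_lt_right [IsRingFiltration F Flt] {i j : ℕ} {a b : R}
    (ha : a ∈ F i) (hb : b ∈ Flt j) : a * b ∈ Flt (i + j) := by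
  have h : Flt j ≤ (Flt (i + j)).comap (LinearMap.mulLeft ℂ a) := by
    refine IsFiltration.is_sup (F := F) _ j fun m hm c hc => ?_
    exact IsFiltration.is_le (F := F) (by omega : i + m < i + j)
      (SetLike.GradedMul.mul_mem ha hc)
  exact h hb

variable (F) in
/-- The product of `R`, as a bilinear map `F i × F j → F (i + j)`. -/
def filtMul [SetLike.GradedMonoid F] (i j : ℕ) : F i →ₗ[ℂ] F j →ₗ[ℂ] F (i + j) :=
  LinearMap.mk₂ ℂ (fun a b => ⟨a * b, SetLike.GradedMul.mul_mem a.2 b.2⟩)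
    (fun a a' b => Subtype.ext (add_mul (a : R) a' b))
    (fun c a b => Subtype.ext (smul_mul_assoc c (a : R) b))
    (fun a b b' => Subtype.ext (mul_add (a : R) b b'))
    (fun c a b => Subtype.ext (mul_smul_comm c (a : R) b))

variable (F Flt) in
/-- The product of the associated graded algebra: `[a] * [b] = [a * b]`. -/
def grMul [IsRingFiltration F Flt] (i j : ℕ) :
    GrPiece F Flt i →ₗ[ℂ] GrPiece F Flt j →ₗ[ℂ] GrPiece F Flt (i + j) :=
  Submodule.liftQ _
    { toFun := fun a => Submodule.liftQ _ (grClass F Flt (i + j) ∘ₗ filtMul F i j a) (by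
        intro b hb
        rw [LinearMap.mem_ker, LinearMap.comp_apply, Submodule.mkQ_apply,
          Submodule.Quotient.mk_eq_zero]
        exact mul_mem_lt_right a.2 hb)
      map_add' := fun a a' => by
        refine Submodule.linearMap_qext _ (LinearMap.ext fun b => ?_)
        simp
      map_smul' := fun c a => by
        refine Submodule.linearMap_qext _ (LinearMap.ext fun b => ?_)
        simp }
    (by
      intro a ha
      rw [LinearMap.mem_ker]
      refine Submodule.linearMap_qext _ (LinearMap.ext fun b => ?_)
      change grClass F Flt (i + j) (filtMul F i j a b) = 0
      rw [Submodule.mkQ_apply, Submodule.Quotient.mk_eq_zero]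
      exact mul_mem_lt_left ha b.2)

theorem grMul_class [IsRingFiltration F Flt] {i j : ℕ} (a : F i) (b : F j) :
    grMul F Flt i j (grClass F Flt i a) (grClass F Flt j b) =
      grClass F Flt (i + j) ⟨a * b, SetLike.GradedMul.mul_mem a.2 b.2⟩ := rfl

theorem grClass_heq {i j : ℕ} (h : i = j) (a : F i) (b : F j) (hab : (a : R) = b) :
    (⟨i, grClass F Flt i a⟩ : GradedMonoid (GrPiece F Flt)) = ⟨j, grClass F Flt j b⟩ := by
  subst h
  rw [Subtype.ext hab]

instance [IsRingFiltration F Flt] : GradedMonoid.GMul (GrPiece F Flt) where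
  mul a b := grMul F Flt _ _ a b

instance [IsRingFiltration F Flt] : GradedMonoid.GOne (GrPiece F Flt) where
  one := grClass F Flt 0 ⟨1, SetLike.GradedOne.one_mem⟩

instance [IsRingFiltration F Flt] : DirectSum.GSemiring (GrPiece F Flt) where
  one_mul := by
    rintro ⟨i, a⟩
    obtain ⟨a, rfl⟩ := Submodule.mkQ_surjective _ a
    exact grClass_heq (zero_add i) _ _ (one_mul (a : R))
  mul_one := by
    rintro ⟨i, a⟩
    obtain ⟨a, rfl⟩ := Submodule.mkQ_surjective _ a
    exact grClass_heq (add_zero i) _ _ (mul_one (a : R))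
  mul_assoc := by
    rintro ⟨i, a⟩ ⟨j, b⟩ ⟨k, c⟩
    obtain ⟨a, rfl⟩ := Submodule.mkQ_surjective _ a
    obtain ⟨b, rfl⟩ := Submodule.mkQ_surjective _ b
    obtain ⟨c, rfl⟩ := Submodule.mkQ_surjective _ c
    exact grClass_heq (add_assoc i j k) _ _ (mul_assoc (a : R) b c)
  mul_zero a := map_zero (grMul F Flt _ _ a)
  zero_mul b := LinearMap.map_zero₂ (grMul F Flt _ _) b
  mul_add a b c := map_add (grMul F Flt _ _ a) b c
  add_mul a b c := LinearMap.map_add₂ (grMul F Flt _ _) a b c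
  natCast n := grClass F Flt 0 (n • ⟨1, SetLike.GradedOne.one_mem⟩)
  natCast_zero := by rw [zero_smul, map_zero]
  natCast_succ n := by
    rw [succ_nsmul, map_add]
    rfl

instance [IsRingFiltration F Flt] : DirectSum.GAlgebra ℂ (GrPiece F Flt) where
  toFun :=
    ((grClass F Flt 0).comp
      (LinearMap.toSpanSingleton ℂ (F 0) ⟨1, SetLike.GradedOne.one_mem⟩)).toAddMonoidHom
  map_one := by
    change grClass F Flt 0 ((1 : ℂ) • _) = _
    rw [one_smul]
    rfl
  map_mul r s := by
    refine grClass_heq (add_zero 0).symm _ _ ?_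
    change (r * s) • (1 : R) = (r • (1 : R)) * (s • (1 : R))
    rw [smul_mul_smul_comm, one_mul]
  commutes := by
    rintro r ⟨i, a⟩
    obtain ⟨a, rfl⟩ := Submodule.mkQ_surjective _ a
    refine grClass_heq (add_comm 0 i) _ _ ?_
    change (r • (1 : R)) * a = a * (r • (1 : R))
    rw [smul_mul_assoc, mul_smul_comm, one_mul, mul_one]
  smul_def := by
    rintro r ⟨i, a⟩
    obtain ⟨a, rfl⟩ := Submodule.mkQ_surjective _ a
    refine grClass_heq (zero_add i).symm (r • a) _ ?_
    change r • (a : R) = (r • (1 : R)) * a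
    rw [smul_mul_assoc, one_mul]

variable (F Flt) in
/-- The associated graded algebra `gr R = ⨁ n, F n / F_{<n}`, with `[a] * [b] = [a * b]`. -/
def AssocGraded [IsRingFiltration F Flt] : Type u := ⨁ n, GrPiece F Flt n

instance [IsRingFiltration F Flt] : Ring (AssocGraded F Flt) :=
  Algebra.semiringToRing (A := ⨁ n, GrPiece F Flt n) ℂ

instance [IsRingFiltration F Flt] : Algebra ℂ (AssocGraded F Flt) :=
  inferInstanceAs (Algebra ℂ (⨁ n, GrPiece F Flt n))

variable (F Flt) in
/-- The inclusion of the degree `n` piece into the associated graded algebra. -/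
def grIncl [IsRingFiltration F Flt] (n : ℕ) : GrPiece F Flt n →ₗ[ℂ] AssocGraded F Flt :=
  DirectSum.lof ℂ ℕ (GrPiece F Flt) n

variable (F Flt) in
/-- The class of `a ∈ F n`, placed in degree `n` of the associated graded algebra. -/
def grOf [IsRingFiltration F Flt] (n : ℕ) : F n →ₗ[ℂ] AssocGraded F Flt :=
  grIncl F Flt n ∘ₗ grClass F Flt n

theorem grOf_congr [IsRingFiltration F Flt] {i j : ℕ} (h : i = j) (a : F i) (b : F j) (hab : (a : R) = b) :
    grOf F Flt i a = grOf F Flt j b := by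
  subst h
  rw [Subtype.ext hab]

theorem grOf_mul [IsRingFiltration F Flt] {i j : ℕ} (a : F i) (b : F j) :
    grOf F Flt i a * grOf F Flt j b =
      grOf F Flt (i + j) ⟨a * b, SetLike.GradedMul.mul_mem a.2 b.2⟩ :=
  DirectSum.of_mul_of (A := GrPiece F Flt) _ _

theorem grOf_one [IsRingFiltration F Flt] :
    grOf F Flt 0 ⟨1, SetLike.GradedOne.one_mem⟩ = 1 := rfl

theorem grOf_eq_zero [IsRingFiltration F Flt] {n : ℕ} (a : F n) (ha : (a : R) ∈ Flt n) :
    grOf F Flt n a = 0 := by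
  have : grClass F Flt n a = 0 := by
    rw [Submodule.mkQ_apply, Submodule.Quotient.mk_eq_zero]
    exact ha
  rw [grOf, LinearMap.comp_apply, this, map_zero]

end AssociatedGraded

/-! ### Algebraic distributions and algebraic representations

An affine algebraic group `G` over `ℂ` is given by its algebra `A = O(G)` of regular functions,
a commutative Hopf algebra of finite type; `Δ f (g, h) = f (g h)`.  The (closed) points of `G`
are the algebra homomorphisms `A →ₐ[ℂ] ℂ`. -/

section Distributions

/-- Algebraic distributions on `G`: the linear dual `O(G)^*`, with the convolution product
`(μ * ν) f = (μ ⊗ ν) (Δ f)`; the unit is the delta function at `1`. -/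
abbrev Distribution (A : Type u) [CommRing A] [HopfAlgebra ℂ A] : Type u :=
  WithConv (A →ₗ[ℂ] ℂ)

variable {A : Type u} [CommRing A] [HopfAlgebra ℂ A]

/-- The `O(G)`-module structure on distributions: `(f μ, h) = (μ, f h)`. -/
def fsmul : A →ₗ[ℂ] Distribution A →ₗ[ℂ] Distribution A :=
  LinearMap.mk₂ ℂ (fun f μ => WithConv.toConv (μ.ofConv ∘ₗ LinearMap.mulLeft ℂ f))
    (fun f f' μ => by ext h; simp [add_mul])
    (fun c f μ => by ext h; simp)
    (fun f μ ν => by ext h; simp)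
    (fun c f μ => by ext h; simp)

/-- The delta function at the point `g`. -/
def delta (g : A →ₐ[ℂ] ℂ) : Distribution A := WithConv.toConv g.toLinearMap

/-- The delta function at the point `g⁻¹`. -/
def deltaInv (g : A →ₐ[ℂ] ℂ) : Distribution A :=
  WithConv.toConv (g.toLinearMap ∘ₗ HopfAlgebra.antipode ℂ)

/-- The distribution `μ` is supported on the closed subscheme of `G` with ideal `I`. -/
def SupportedOn (μ : Distribution A) (I : Ideal A) : Prop := ∀ f ∈ I, μ f = 0

/-- The ideal of all regular functions that vanish on a set of points. -/
def vanishingIdeal (S : Set (A →ₐ[ℂ] ℂ)) : Ideal A := ⨅ g ∈ S, RingHom.ker g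

/-- The distribution `μ` is set-theoretically supported on the set of points `S`: it annihilates
some power of the ideal of `S`. -/
def SetSupportedOn (μ : Distribution A) (S : Set (A →ₐ[ℂ] ℂ)) : Prop :=
  ∃ n : ℕ, SupportedOn μ (vanishingIdeal S ^ n)

variable (A) in
/-- An algebraic representation of `G` on `V`: a (right) coaction of `O(G)` on `V`.
If `coact x = ∑ vᵢ ⊗ aᵢ` then `g x = ∑ aᵢ(g) vᵢ`. -/
structure AlgRep (V : Type v) [AddCommGroup V] [Module ℂ V] where
  /-- The coaction. -/
  coact : V →ₗ[ℂ] V ⊗[ℂ] A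
  counit_coact :
    (TensorProduct.rid ℂ V).toLinearMap ∘ₗ (Coalgebra.counit (R := ℂ) (A := A)).lTensor V ∘ₗ coact
      = LinearMap.id
  coassoc_coact :
    (TensorProduct.assoc ℂ V A A).toLinearMap ∘ₗ coact.rTensor A ∘ₗ coact
      = (Coalgebra.comul (R := ℂ) (A := A)).lTensor V ∘ₗ coact

variable {V : Type v} [AddCommGroup V] [Module ℂ V]

/-- The action of a point `g` of `G` on `V`. -/
def AlgRep.act (ρ : AlgRep A V) (g : A →ₐ[ℂ] ℂ) : V →ₗ[ℂ] V :=
  (TensorProduct.rid ℂ V).toLinearMap ∘ₗ g.toLinearMap.lTensor V ∘ₗ ρ.coact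

/-- The universal element `g` of `G` acting on `V`, as an `O(G)`-linear endomorphism of
`O(G) ⊗ V` (a matrix of regular functions on `G`). -/
def AlgRep.univ (ρ : AlgRep A V) : A ⊗[ℂ] V →ₗ[A] A ⊗[ℂ] V :=
  LinearMap.liftBaseChange A ((TensorProduct.comm ℂ V A).toLinearMap ∘ₗ ρ.coact)

/-- The ideal of the closed subscheme `Φ ⊂ G` defined by `∧³(1 - g|_V) = 0`: it is generated by
the matrix coefficients of the `O(G)`-linear endomorphism `∧³(1 - g)` of `∧³(O(G) ⊗ V)`. -/
def AlgRep.idealPhi (ρ : AlgRep A V) : Ideal A :=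
  Ideal.span {a : A | ∃ (w : ⋀[A]^3 (A ⊗[ℂ] V)) (φ : Module.Dual A (⋀[A]^3 (A ⊗[ℂ] V))),
    φ (exteriorPower.map 3 (LinearMap.id - ρ.univ) w) = a}

/-- The set `S` of the points `g` of `G` such that `1 - g` has rank at most `2` on `V`. -/
def AlgRep.rankLeTwo (ρ : AlgRep A V) : Set (A →ₐ[ℂ] ℂ) :=
  {g | (LinearMap.id - ρ.act g : V →ₗ[ℂ] V).rank ≤ 2}

/-- Skew-symmetry of a bilinear pairing with values in distributions. -/
def IsSkew (κ : V →ₗ[ℂ] V →ₗ[ℂ] Distribution A) : Prop := ∀ x y, κ x y = -κ y x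

/-- `G`-equivariance of a pairing, where `G` acts on distributions by conjugation. -/
def IsEquivariant (ρ : AlgRep A V) (κ : V →ₗ[ℂ] V →ₗ[ℂ] Distribution A) : Prop :=
  ∀ (g : A →ₐ[ℂ] ℂ) (x y : V),
    κ (ρ.act g x) (ρ.act g y) = delta g * κ x y * deltaInv g

end Distributions

/-! ### The algebras `TV ⋊ O(G)^*` and `H_κ` -/

section Hecke

variable {A : Type u} [CommRing A] [HopfAlgebra ℂ A] {V : Type v} [AddCommGroup V] [Module ℂ V]

/-- For linear maps `i` and `j` from `V` and `O(G)^*` to an algebra, the linear map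
`v ⊗ f ↦ i v * j (f μ)`.  Applied to the coaction of `x` it gives `∑ vᵢ · (vᵢ^*, g x) μ`. -/
def crossTerm {R : Type*} [Ring R] [Algebra ℂ R] (i : V →ₗ[ℂ] R) (j : Distribution A →ₗ[ℂ] R)
    (μ : Distribution A) : V ⊗[ℂ] A →ₗ[ℂ] R :=
  TensorProduct.lift ((LinearMap.mul ℂ R).compl₁₂ i (j ∘ₗ fsmul.flip μ))

theorem crossTerm_tmul {R : Type*} [Ring R] [Algebra ℂ R] (i : V →ₗ[ℂ] R)
    (j : Distribution A →ₗ[ℂ] R) (μ : Distribution A) (x : V) (f : A) :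
    crossTerm i j μ (x ⊗ₜ[ℂ] f) = i x * j (fsmul f μ) := rfl

theorem map_crossTerm {R R' : Type*} [Ring R] [Algebra ℂ R] [Ring R'] [Algebra ℂ R']
    (φ : R →ₐ[ℂ] R') (i : V →ₗ[ℂ] R) (j : Distribution A →ₗ[ℂ] R) (μ : Distribution A)
    (t : V ⊗[ℂ] A) :
    φ (crossTerm i j μ t) = crossTerm (φ.toLinearMap ∘ₗ i) (φ.toLinearMap ∘ₗ j) μ t := by
  induction t with
  | zero => simp
  | add s t hs ht => simp only [map_add, hs, ht]
  | tmul x f => simp [crossTerm_tmul]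

variable (A V) in
/-- The generator of the free algebra on `V` and `O(G)^*` given by a vector. -/
def genVec : V →ₗ[ℂ] TensorAlgebra ℂ (V × Distribution A) :=
  TensorAlgebra.ι ℂ ∘ₗ LinearMap.inl ℂ V (Distribution A)

variable (A V) in
/-- The generator of the free algebra on `V` and `O(G)^*` given by a distribution. -/
def genDist : Distribution A →ₗ[ℂ] TensorAlgebra ℂ (V × Distribution A) :=
  TensorAlgebra.ι ℂ ∘ₗ LinearMap.inr ℂ V (Distribution A)

/-- The relations of `TV ⋊ O(G)^*`: the distributions multiply by convolution, and
`μ · x = ∑ vᵢ · (vᵢ^*, g x) μ`. -/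
inductive SmashRel (ρ : AlgRep A V) :
    TensorAlgebra ℂ (V × Distribution A) → TensorAlgebra ℂ (V × Distribution A) → Prop
  | one : SmashRel ρ (genDist A V 1) 1
  | mul (μ ν : Distribution A) :
      SmashRel ρ (genDist A V (μ * ν)) (genDist A V μ * genDist A V ν)
  | cross (μ : Distribution A) (x : V) :
      SmashRel ρ (genDist A V μ * genVec A V x)
        (crossTerm (genVec A V) (genDist A V) μ (ρ.coact x))

/-- The semi-direct product `TV ⋊ O(G)^*`. -/
def Smash (ρ : AlgRep A V) : Type (max u v) := RingQuot (SmashRel ρ)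

instance (ρ : AlgRep A V) : Ring (Smash ρ) := inferInstanceAs (Ring (RingQuot (SmashRel ρ)))

instance (ρ : AlgRep A V) : Algebra ℂ (Smash ρ) :=
  inferInstanceAs (Algebra ℂ (RingQuot (SmashRel ρ)))

/-- The quotient map from the free algebra on `V` and `O(G)^*` to `TV ⋊ O(G)^*`. -/
def smashMk (ρ : AlgRep A V) : TensorAlgebra ℂ (V × Distribution A) →ₐ[ℂ] Smash ρ :=
  RingQuot.mkAlgHom ℂ (SmashRel ρ)

theorem smashMk_rel {ρ : AlgRep A V} {a b : TensorAlgebra ℂ (V × Distribution A)}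
    (h : SmashRel ρ a b) : smashMk ρ a = smashMk ρ b :=
  RingQuot.mkAlgHom_rel ℂ h

/-- The universal property of `TV ⋊ O(G)^*`. -/
def smashLift (ρ : AlgRep A V) {R : Type*} [Ring R] [Algebra ℂ R]
    (f : TensorAlgebra ℂ (V × Distribution A) →ₐ[ℂ] R)
    (hf : ∀ a b, SmashRel ρ a b → f a = f b) : Smash ρ →ₐ[ℂ] R :=
  RingQuot.liftAlgHom ℂ ⟨f, fun a b h => hf a b h⟩

theorem smashLift_mk (ρ : AlgRep A V) {R : Type*} [Ring R] [Algebra ℂ R]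
    (f : TensorAlgebra ℂ (V × Distribution A) →ₐ[ℂ] R)
    (hf : ∀ a b, SmashRel ρ a b → f a = f b) (a : TensorAlgebra ℂ (V × Distribution A)) :
    smashLift ρ f hf (smashMk ρ a) = f a :=
  RingQuot.liftAlgHom_mkAlgHom_apply ℂ f _ a

/-- The canonical map `V → TV ⋊ O(G)^*`. -/
def smashVec (ρ : AlgRep A V) : V →ₗ[ℂ] Smash ρ :=
  (smashMk ρ).toLinearMap ∘ₗ genVec A V

/-- The canonical map `O(G)^* → TV ⋊ O(G)^*`. -/
def smashDist (ρ : AlgRep A V) : Distribution A →ₗ[ℂ] Smash ρ :=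
  (smashMk ρ).toLinearMap ∘ₗ genDist A V

/-- The relations `[x, y] = κ(x, y)`. -/
inductive HeckeRel (ρ : AlgRep A V) (κ : V →ₗ[ℂ] V →ₗ[ℂ] Distribution A) :
    Smash ρ → Smash ρ → Prop
  | comm (x y : V) :
      HeckeRel ρ κ (smashVec ρ x * smashVec ρ y - smashVec ρ y * smashVec ρ x)
        (smashDist ρ (κ x y))

/-- The algebra `H_κ`. -/
def Hecke (ρ : AlgRep A V) (κ : V →ₗ[ℂ] V →ₗ[ℂ] Distribution A) : Type (max u v) :=
  RingQuot (HeckeRel ρ κ)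

instance (ρ : AlgRep A V) (κ : V →ₗ[ℂ] V →ₗ[ℂ] Distribution A) : Ring (Hecke ρ κ) :=
  inferInstanceAs (Ring (RingQuot (HeckeRel ρ κ)))

instance (ρ : AlgRep A V) (κ : V →ₗ[ℂ] V →ₗ[ℂ] Distribution A) : Algebra ℂ (Hecke ρ κ) :=
  inferInstanceAs (Algebra ℂ (RingQuot (HeckeRel ρ κ)))

variable (ρ : AlgRep A V) (κ : V →ₗ[ℂ] V →ₗ[ℂ] Distribution A)

/-- The quotient map from `TV ⋊ O(G)^*` to `H_κ`. -/
def heckeMk : Smash ρ →ₐ[ℂ] Hecke ρ κ := RingQuot.mkAlgHom ℂ (HeckeRel ρ κ)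

variable {ρ κ} in
theorem heckeMk_rel {a b : Smash ρ} (h : HeckeRel ρ κ a b) : heckeMk ρ κ a = heckeMk ρ κ b :=
  RingQuot.mkAlgHom_rel ℂ h

/-- The universal property of `H_κ`. -/
def heckeLift {R : Type*} [Ring R] [Algebra ℂ R] (f : Smash ρ →ₐ[ℂ] R)
    (hf : ∀ a b, HeckeRel ρ κ a b → f a = f b) : Hecke ρ κ →ₐ[ℂ] R :=
  RingQuot.liftAlgHom ℂ ⟨f, fun a b h => hf a b h⟩

theorem heckeLift_mk {R : Type*} [Ring R] [Algebra ℂ R] (f : Smash ρ →ₐ[ℂ] R)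
    (hf : ∀ a b, HeckeRel ρ κ a b → f a = f b) (a : Smash ρ) :
    heckeLift ρ κ f hf (heckeMk ρ κ a) = f a :=
  RingQuot.liftAlgHom_mkAlgHom_apply ℂ f _ a

/-- The canonical map `V → H_κ`. -/
def vec : V →ₗ[ℂ] Hecke ρ κ :=
  (heckeMk ρ κ).toLinearMap ∘ₗ smashVec ρ

/-- The canonical map `O(G)^* → H_κ`. -/
def dist : Distribution A →ₗ[ℂ] Hecke ρ κ :=
  (heckeMk ρ κ).toLinearMap ∘ₗ smashDist ρ

theorem dist_one : dist ρ κ 1 = 1 := by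
  have h := smashMk_rel (SmashRel.one (ρ := ρ))
  change heckeMk ρ κ (smashMk ρ _) = 1
  rw [h, map_one, map_one]

theorem dist_mul (μ ν : Distribution A) : dist ρ κ (μ * ν) = dist ρ κ μ * dist ρ κ ν := by
  have h := smashMk_rel (SmashRel.mul (ρ := ρ) μ ν)
  change heckeMk ρ κ (smashMk ρ _) = _
  rw [h, map_mul, map_mul]
  rfl

theorem dist_mul_vec (μ : Distribution A) (x : V) :
    dist ρ κ μ * vec ρ κ x = crossTerm (vec ρ κ) (dist ρ κ) μ (ρ.coact x) := by
  have h := smashMk_rel (SmashRel.cross (ρ := ρ) μ x)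
  change heckeMk ρ κ (smashMk ρ _) *
    heckeMk ρ κ (smashMk ρ _) = _
  rw [← map_mul, ← map_mul, h, map_crossTerm, map_crossTerm]
  rfl

theorem vec_comm (x y : V) :
    vec ρ κ x * vec ρ κ y - vec ρ κ y * vec ρ κ x = dist ρ κ (κ x y) := by
  have h := heckeMk_rel (HeckeRel.comm (ρ := ρ) (κ := κ) x y)
  rw [map_sub, map_mul, map_mul] at h
  exact h

/-- The span of the products of generators in which exactly `k` factors are from `V`
(note that `O(G)^*` is closed under products and contains `1`). -/
def wordSpan (k : ℕ) : Submodule ℂ (Hecke ρ κ) :=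
  LinearMap.range (dist ρ κ) * (LinearMap.range (vec ρ κ) * LinearMap.range (dist ρ κ)) ^ k

/-- The filtration of `H_κ` given by `deg x = 1` for `x ∈ V` and `deg μ = 0` for `μ ∈ O(G)^*`. -/
def filt (n : ℕ) : Submodule ℂ (Hecke ρ κ) := ⨆ k ≤ n, wordSpan ρ κ k

/-- The part of degree less than `n`. -/
def filtLt (n : ℕ) : Submodule ℂ (Hecke ρ κ) := ⨆ m < n, filt ρ κ m

theorem wordSpan_le_filt {k n : ℕ} (h : k ≤ n) : wordSpan ρ κ k ≤ filt ρ κ n :=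
  le_iSup₂_of_le k h le_rfl

theorem range_dist_mul :
    LinearMap.range (dist ρ κ) * LinearMap.range (dist ρ κ) ≤ LinearMap.range (dist ρ κ) := by
  rw [Submodule.mul_le]
  rintro _ ⟨μ, rfl⟩ _ ⟨ν, rfl⟩
  exact ⟨μ * ν, dist_mul ρ κ μ ν⟩

theorem wordSpan_mul_dist (k : ℕ) :
    wordSpan ρ κ k * LinearMap.range (dist ρ κ) ≤ wordSpan ρ κ k := by
  cases k with
  | zero => simpa [wordSpan] using range_dist_mul ρ κ
  | succ k =>
    rw [wordSpan, pow_succ]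
    simp only [mul_assoc]
    gcongr
    exact range_dist_mul ρ κ

theorem wordSpan_mul (i j : ℕ) :
    wordSpan ρ κ i * wordSpan ρ κ j ≤ wordSpan ρ κ (i + j) := by
  calc wordSpan ρ κ i * wordSpan ρ κ j
      = (wordSpan ρ κ i * LinearMap.range (dist ρ κ)) *
          (LinearMap.range (vec ρ κ) * LinearMap.range (dist ρ κ)) ^ j := by
        rw [mul_assoc]; rfl
    _ ≤ wordSpan ρ κ i * (LinearMap.range (vec ρ κ) * LinearMap.range (dist ρ κ)) ^ j := by
        gcongr
        exact wordSpan_mul_dist ρ κ i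
    _ = wordSpan ρ κ (i + j) := by
        rw [wordSpan, wordSpan, pow_add, mul_assoc]

theorem filt_mul (i j : ℕ) : filt ρ κ i * filt ρ κ j ≤ filt ρ κ (i + j) := by
  simp only [filt, Submodule.iSup_mul, Submodule.mul_iSup, iSup_le_iff]
  intro k hk l hl
  exact (wordSpan_mul ρ κ _ _).trans (wordSpan_le_filt ρ κ (by omega))

theorem dist_mem_filt (μ : Distribution A) : dist ρ κ μ ∈ filt ρ κ 0 :=
  wordSpan_le_filt ρ κ le_rfl (by simp [wordSpan])

theorem vec_mem_filt (x : V) : vec ρ κ x ∈ filt ρ κ 1 := by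
  refine wordSpan_le_filt ρ κ le_rfl ?_
  have h1 : (1 : Hecke ρ κ) ∈ LinearMap.range (dist ρ κ) := ⟨1, dist_one ρ κ⟩
  have hx : vec ρ κ x ∈ LinearMap.range (vec ρ κ) := ⟨x, rfl⟩
  have h := Submodule.mul_mem_mul h1 (Submodule.mul_mem_mul hx h1)
  simpa [wordSpan] using h

instance : IsRingFiltration (filt ρ κ) (filtLt ρ κ) where
  mono i j h := iSup₂_le fun _ hk => wordSpan_le_filt ρ κ (hk.trans h)
  is_le {i _} h := le_iSup₂_of_le i h le_rfl
  is_sup _ _ h := iSup₂_le h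
  one_mem := by
    rw [← dist_one ρ κ]
    exact dist_mem_filt ρ κ 1
  mul_mem _ _ _ _ ha hb := filt_mul ρ κ _ _ (Submodule.mul_mem_mul ha hb)

/-- The associated graded algebra `gr(H_κ)`. -/
abbrev GrHecke : Type (max u v) := AssocGraded (filt ρ κ) (filtLt ρ κ)

/-- The class of `x ∈ V` in degree `1` of `gr(H_κ)`. -/
def grVec : V →ₗ[ℂ] GrHecke ρ κ :=
  grOf (filt ρ κ) (filtLt ρ κ) 1 ∘ₗ (vec ρ κ).codRestrict (filt ρ κ 1) (vec_mem_filt ρ κ)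

/-- The class of `μ ∈ O(G)^*` in degree `0` of `gr(H_κ)`. -/
def grDist : Distribution A →ₗ[ℂ] GrHecke ρ κ :=
  grOf (filt ρ κ) (filtLt ρ κ) 0 ∘ₗ (dist ρ κ).codRestrict (filt ρ κ 0) (dist_mem_filt ρ κ)

theorem grDist_one : grDist ρ κ 1 = 1 :=
  grOf_congr rfl _ _ (dist_one ρ κ)

theorem grDist_mul (μ ν : Distribution A) :
    grDist ρ κ (μ * ν) = grDist ρ κ μ * grDist ρ κ ν := by
  refine Eq.trans ?_ (grOf_mul _ _).symm
  exact grOf_congr rfl _ _ (dist_mul ρ κ μ ν)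

theorem crossTerm_mem (μ : Distribution A) (t : V ⊗[ℂ] A) :
    crossTerm (vec ρ κ) (dist ρ κ) μ t ∈ filt ρ κ 1 := by
  induction t with
  | zero => simp
  | add s t hs ht => rw [map_add]; exact add_mem hs ht
  | tmul x f =>
    exact filt_mul ρ κ 1 0 (Submodule.mul_mem_mul (vec_mem_filt ρ κ x) (dist_mem_filt ρ κ _))

theorem grCrossTerm (μ : Distribution A) (t : V ⊗[ℂ] A) :
    crossTerm (grVec ρ κ) (grDist ρ κ) μ t =
      grOf (filt ρ κ) (filtLt ρ κ) 1 ⟨_, crossTerm_mem ρ κ μ t⟩ := by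
  induction t with
  | zero =>
    rw [map_zero, ← map_zero (grOf (filt ρ κ) (filtLt ρ κ) 1)]
    exact grOf_congr rfl _ _ (map_zero _).symm
  | add s t hs ht =>
    rw [map_add, hs, ht, ← map_add]
    exact grOf_congr rfl _ _ (map_add _ _ _).symm
  | tmul x f => exact grOf_mul _ _

theorem grDist_mul_grVec (μ : Distribution A) (x : V) :
    grDist ρ κ μ * grVec ρ κ x = crossTerm (grVec ρ κ) (grDist ρ κ) μ (ρ.coact x) := by
  rw [grCrossTerm]
  refine (grOf_mul _ _).trans ?_
  exact grOf_congr (zero_add 1) _ _ (dist_mul_vec ρ κ μ x)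

theorem grVec_comm (x y : V) : grVec ρ κ x * grVec ρ κ y - grVec ρ κ y * grVec ρ κ x = 0 := by
  have h : grVec ρ κ x * grVec ρ κ y - grVec ρ κ y * grVec ρ κ x =
      grOf (filt ρ κ) (filtLt ρ κ) (1 + 1) ⟨dist ρ κ (κ x y),
        wordSpan_le_filt ρ κ (Nat.zero_le _) (by simp [wordSpan])⟩ := by
    have e1 : grVec ρ κ x * grVec ρ κ y = _ := grOf_mul _ _
    have e2 : grVec ρ κ y * grVec ρ κ x = _ := grOf_mul _ _
    rw [e1, e2, ← map_sub]
    exact grOf_congr rfl _ _ (vec_comm ρ κ x y)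
  rw [h]
  exact grOf_eq_zero _ (IsFiltration.is_le (F := filt ρ κ) (by omega : 0 < 1 + 1)
    (dist_mem_filt ρ κ _))

/-- The algebra map `TV ⋊ O(G)^* → gr(H_κ)`. -/
def smashToGr : Smash ρ →ₐ[ℂ] GrHecke ρ κ :=
  smashLift ρ (TensorAlgebra.lift ℂ ((grVec ρ κ).coprod (grDist ρ κ))) <| by
    have hv : (TensorAlgebra.lift ℂ ((grVec ρ κ).coprod (grDist ρ κ))).toLinearMap ∘ₗ genVec A V
        = grVec ρ κ := by
      ext x; simp [genVec]
    have hd : (TensorAlgebra.lift ℂ ((grVec ρ κ).coprod (grDist ρ κ))).toLinearMap ∘ₗ genDist A V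
        = grDist ρ κ := by
      ext x; simp [genDist]
    have hv' := fun x => LinearMap.congr_fun hv x
    have hd' := fun x => LinearMap.congr_fun hd x
    simp only [LinearMap.comp_apply, AlgHom.toLinearMap_apply] at hv' hd'
    intro a b h
    cases h with
    | one => exact (hd' 1).trans ((grDist_one ρ κ).trans (map_one _).symm)
    | mul μ ν => rw [hd', grDist_mul, ← hd' μ, ← hd' ν, ← map_mul]
    | cross μ x => rw [map_mul, hd', hv', map_crossTerm, hv, hd, grDist_mul_grVec]

theorem smashToGr_vec (x : V) : smashToGr ρ κ (smashVec ρ x) = grVec ρ κ x := by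
  simp [smashToGr, smashVec, genVec, smashLift_mk]

theorem smashToGr_dist (μ : Distribution A) : smashToGr ρ κ (smashDist ρ μ) = grDist ρ κ μ := by
  simp [smashToGr, smashDist, genDist, smashLift_mk]

/-- The natural algebra map `H_0 = SV ⋊ O(G)^* → gr(H_κ)`; it sends `x ∈ V` to its class in
degree `1` and `μ ∈ O(G)^*` to its class in degree `0`. -/
def toGr : Hecke ρ (0 : V →ₗ[ℂ] V →ₗ[ℂ] Distribution A) →ₐ[ℂ] GrHecke ρ κ :=
  heckeLift ρ 0 (smashToGr ρ κ) <| by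
    intro a b h
    cases h with
    | comm x y =>
      rw [map_sub, map_mul, map_mul, smashToGr_vec, smashToGr_vec, grVec_comm]
      simp

theorem toGr_vec (x : V) : toGr ρ κ (vec ρ 0 x) = grVec ρ κ x := by
  simp [toGr, vec, heckeLift_mk, smashToGr_vec]

theorem toGr_dist (μ : Distribution A) : toGr ρ κ (dist ρ 0 μ) = grDist ρ κ μ := by
  simp [toGr, dist, heckeLift_mk, smashToGr_dist]

/-- The PBW property for `H_κ`: the natural map `H_0 → gr(H_κ)` is an isomorphism. -/
def HasPBW : Prop := Function.Bijective (toGr ρ κ)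

end Hecke

end ContHecke

end

noncomputable section

namespace ContHecke

universe u v

/-! ### Functions acting on convolution products, and the action of distributions on `V ⊗ O(G)^*`.
-/

section Module

variable {A : Type u} [CommRing A] [HopfAlgebra ℂ A] {V : Type v} [AddCommGroup V] [Module ℂ V]

/-! In `H_κ` the vectors satisfy the Jacobi identity for commutators. Since `[x, y] = κ(x, y)`, it
says that the sum of `[κ(x, y), z]` over cyclic permutations vanishes. Commuting `κ(x, y)` past `z`
produces the element `(g - 1)z · κ(x, y)` of degree one. The PBW property makes the map `V ⊗ O(G)^*
→ H_κ` injective (`HasPBW.vecDist_injective`), so the identity already holds in `V ⊗ O(G)^*`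
(`HasPBW.jacobi`). For this one must know that `V ⊗ O(G)^*` embeds in `H_0`; this follows from an
explicit action of `H_0` on `O(G)^* ⊕ (V ⊗ O(G)^*)`.

Pairing with a functional `ℓ` on `V` and writing `a(z) = (ℓ, (1 - g)z)`, one gets `a ∧ κ = 0`, where
`κ` is a 2-form on `V` with values in the `O(G)`-module of distributions. For three functionals, `a
∧ κ = b ∧ κ = c ∧ κ = 0` forces `(a ∧ b ∧ c) κ = 0` by linear algebra over a commutative ring
(`wedge_three_smul_eq_zero`). Hence every 3 × 3 minor of `1 - g` annihilates all values of `κ`.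
These minors generate `I(Φ)` (`idealPhi_le`, `det_mem_idealPhi`), which gives the scheme-theoretic
statement.

For the set-theoretic one, every closed point of `Φ` lies in `S`, so by the Nullstellensatz the
ideal of `S` is contained in the radical of `I(Φ)`, and by noetherianity a power of it is contained
in `I(Φ)`. -/

theorem fsmul_apply (f : A) (μ : Distribution A) (h : A) : fsmul f μ h = μ (f * h) := rfl

theorem fsmul_one (μ : Distribution A) : fsmul 1 μ = μ := by
  ext h
  simp [fsmul_apply]

theorem fsmul_mul (f g : A) (μ : Distribution A) : fsmul (f * g) μ = fsmul f (fsmul g μ) := by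
  ext h
  simp only [fsmul_apply]
  congr 1
  ring

/-- Multiplication of the unit distribution by a function is evaluation at the unit. -/
theorem fsmul_unit (f : A) :
    fsmul f (1 : Distribution A) = Coalgebra.counit (R := ℂ) f • (1 : Distribution A) := by
  ext h
  simp [fsmul_apply]

/-- The bilinear map `(f ⊗ g) ↦ fμ * gν`. -/
def convTwist (μ ν : Distribution A) : A ⊗[ℂ] A →ₗ[ℂ] Distribution A :=
  TensorProduct.lift ((LinearMap.mul ℂ (Distribution A)).compl₁₂ (fsmul.flip μ) (fsmul.flip ν))

theorem convTwist_tmul (μ ν : Distribution A) (f g : A) :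
    convTwist μ ν (f ⊗ₜ g) = fsmul f μ * fsmul g ν := rfl

/-- This form makes the twist visible as multiplication by `t` in `A ⊗ A`; with `Δ(f h) = Δ(f) Δ(h)`
it yields `fsmul_conv`. -/
theorem convTwist_apply (μ ν : Distribution A) (t : A ⊗[ℂ] A) (h : A) :
    convTwist μ ν t h = LinearMap.mul' ℂ ℂ
      (TensorProduct.map μ.ofConv ν.ofConv (t * Coalgebra.comul (R := ℂ) h)) := by
  induction t with
  | zero => simp
  | add s t hs ht =>
    rw [map_add, add_mul, map_add, map_add, ← hs, ← ht]
    rfl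
  | tmul f g =>
    rw [convTwist_tmul, LinearMap.convMul_apply]
    induction Coalgebra.comul (R := ℂ) h with
    | zero => simp
    | add s t hs ht => simp only [map_add, mul_add, hs, ht]
    | tmul a b => simp [fsmul]

/-- Functions multiply a convolution product through their coproduct. -/
theorem fsmul_conv (f : A) (μ ν : Distribution A) :
    fsmul f (μ * ν) = convTwist μ ν (Coalgebra.comul (R := ℂ) f) := by
  ext h
  rw [convTwist_apply, fsmul_apply, LinearMap.convMul_apply, Bialgebra.comul_mul]

/-- Right multiplication by a distribution on `V ⊗ O(G)^*`. -/
def mulRightDist (ν : Distribution A) : V ⊗[ℂ] Distribution A →ₗ[ℂ] V ⊗[ℂ] Distribution A :=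
  (LinearMap.mulRight ℂ ν).lTensor V

/-- The map `v ⊗ f ↦ v ⊗ fμ`. -/
def twist : Distribution A →ₗ[ℂ] V ⊗[ℂ] A →ₗ[ℂ] V ⊗[ℂ] Distribution A :=
  LinearMap.lTensorHom V ∘ₗ (fsmul (A := A)).flip

theorem twist_tmul (μ : Distribution A) (v : V) (f : A) :
    twist μ (v ⊗ₜ[ℂ] f) = v ⊗ₜ fsmul f μ := rfl

/-- The action of a distribution on `V ⊗ O(G)^*`. -/
def distAct (ρ : AlgRep A V) :
    Distribution A →ₗ[ℂ] V ⊗[ℂ] Distribution A →ₗ[ℂ] V ⊗[ℂ] Distribution A :=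
  LinearMap.mk₂ ℂ (fun μ t => TensorProduct.lift
      ((LinearMap.lTensorHom V ∘ₗ (LinearMap.mul ℂ (Distribution A)).flip).flip ∘ₗ
        twist μ ∘ₗ ρ.coact) t)
    (fun μ μ' t => by
      induction t with
      | zero => simp
      | add s t hs ht =>
        simp only [map_add] at hs ht ⊢
        rw [hs, ht]
        abel
      | tmul v ν => simp)
    (fun c μ t => by
      induction t with
      | zero => simp
      | add s t hs ht => simp only [map_add, hs, ht, smul_add]
      | tmul v ν => simp)
    (fun μ t t' => map_add _ _ _)
    (fun c μ t => map_smul _ _ _)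

theorem distAct_tmul (ρ : AlgRep A V) (μ : Distribution A) (v : V) (ν : Distribution A) :
    distAct ρ μ (v ⊗ₜ ν) = mulRightDist ν (twist μ (ρ.coact v)) := rfl

theorem mulRightDist_mulRightDist (ν ν' : Distribution A) (t : V ⊗[ℂ] Distribution A) :
    mulRightDist ν' (mulRightDist ν t) = mulRightDist (ν * ν') t := by
  induction t with
  | zero => simp
  | add s t hs ht => simp only [map_add, hs, ht]
  | tmul v μ => simp [mulRightDist, mul_assoc]

/-- The two multiplications act from opposite sides, so associativity of convolution suffices. It
lets the right factor be stripped off when the module axioms are checked. -/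
theorem distAct_mulRightDist (ρ : AlgRep A V) (μ ν : Distribution A)
    (t : V ⊗[ℂ] Distribution A) :
    distAct ρ μ (mulRightDist ν t) = mulRightDist ν (distAct ρ μ t) := by
  induction t with
  | zero => simp
  | add s t hs ht => simp only [map_add, hs, ht]
  | tmul v ν' =>
    rw [distAct_tmul, mulRightDist_mulRightDist, ← distAct_tmul]
    rfl

/-- The unit is the delta function at `1`, so a function multiplies it by its value at `1`; the
counit axiom of the coaction then applies. -/
theorem distAct_one (ρ : AlgRep A V) : distAct ρ 1 = LinearMap.id := by
  ext v ν : 3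
  have h1 : ∀ t : V ⊗[ℂ] A, twist 1 t = ((TensorProduct.rid ℂ V).toLinearMap
      ((Coalgebra.counit (R := ℂ) (A := A)).lTensor V t)) ⊗ₜ[ℂ] (1 : Distribution A) := by
    intro t
    induction t with
    | zero => simp
    | add s t hs ht => simp only [map_add, hs, ht, TensorProduct.add_tmul]
    | tmul v f => simp [twist_tmul, fsmul_unit, TensorProduct.smul_tmul]
  have h2 := LinearMap.congr_fun ρ.counit_coact v
  simp only [LinearMap.comp_apply, LinearMap.id_apply] at h2
  change distAct ρ 1 (v ⊗ₜ ν) = v ⊗ₜ ν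
  rw [distAct_tmul, h1, h2]
  simp [mulRightDist]

/-- Both sides apply `convTwist μ ν` to a threefold tensor: one obtained by comultiplying the
coaction, the other by iterating it. Coassociativity identifies the two. -/
theorem distAct_mul (ρ : AlgRep A V) (μ ν : Distribution A) :
    distAct ρ (μ * ν) = distAct ρ μ ∘ₗ distAct ρ ν := by
  have h1 : ∀ t : V ⊗[ℂ] A, twist (μ * ν) t =
      (convTwist μ ν).lTensor V ((Coalgebra.comul (R := ℂ) (A := A)).lTensor V t) := by
    intro t
    induction t with
    | zero => simp
    | add s t hs ht => simp only [map_add, hs, ht]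
    | tmul v f => simp [twist_tmul, fsmul_conv]
  have h2 : ∀ t : V ⊗[ℂ] A, distAct ρ μ (twist ν t) =
      (convTwist μ ν).lTensor V ((TensorProduct.assoc ℂ V A A) (ρ.coact.rTensor A t)) := by
    intro t
    induction t with
    | zero => simp
    | add s t hs ht => simp only [map_add, hs, ht]
    | tmul v f =>
      rw [twist_tmul, distAct_tmul, LinearMap.rTensor_tmul]
      induction ρ.coact v with
      | zero => simp
      | add s t hs ht => simp only [map_add, hs, ht, TensorProduct.add_tmul]
      | tmul w g => simp [twist_tmul, mulRightDist, convTwist_tmul]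
  ext v κ : 3
  change distAct ρ (μ * ν) (v ⊗ₜ κ) = distAct ρ μ (distAct ρ ν (v ⊗ₜ κ))
  have h3 := LinearMap.congr_fun ρ.coassoc_coact v
  simp only [LinearMap.comp_apply, LinearEquiv.coe_coe] at h3
  rw [distAct_tmul, distAct_tmul, distAct_mulRightDist, h1, h2, h3]

/-! ### The action of `H_0` on the truncation of `SV ⊗ O(G)^*` to degrees at most one. -/

variable (V) in
/-- The action of a vector on `O(G)^* ⊕ (V ⊗ O(G)^*)`, the truncation of `SV ⊗ O(G)^*`. -/
def truncVec : V →ₗ[ℂ] Module.End ℂ (Distribution A × V ⊗[ℂ] Distribution A) :=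
  LinearMap.mk₂ ℂ (fun v p => (0, v ⊗ₜ p.1))
    (fun v w p => by simp [TensorProduct.add_tmul])
    (fun c v p => by simp [TensorProduct.smul_tmul'])
    (fun v p q => by simp [TensorProduct.tmul_add])
    (fun c v p => by simp)

theorem truncVec_apply (v : V) (p : Distribution A × V ⊗[ℂ] Distribution A) :
    truncVec V v p = (0, v ⊗ₜ p.1) := rfl

/-- The action of a distribution on `O(G)^* ⊕ (V ⊗ O(G)^*)`. -/
def truncDist (ρ : AlgRep A V) :
    Distribution A →ₗ[ℂ] Module.End ℂ (Distribution A × V ⊗[ℂ] Distribution A) :=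
  LinearMap.mk₂ ℂ (fun μ p => (μ * p.1, distAct ρ μ p.2))
    (fun μ ν p => by simp [add_mul])
    (fun c μ p => by simp [smul_mul_assoc])
    (fun μ p q => by simp [mul_add])
    (fun c μ p => by simp [mul_smul_comm])

theorem truncDist_apply (ρ : AlgRep A V) (μ : Distribution A)
    (p : Distribution A × V ⊗[ℂ] Distribution A) :
    truncDist ρ μ p = (μ * p.1, distAct ρ μ p.2) := rfl

theorem truncDist_mul_truncVec (ρ : AlgRep A V) (μ : Distribution A) (x : V) :
    truncDist ρ μ * truncVec V x = crossTerm (truncVec V) (truncDist ρ) μ (ρ.coact x) := by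
  have h : ∀ (t : V ⊗[ℂ] A) (p : Distribution A × V ⊗[ℂ] Distribution A),
      crossTerm (truncVec V) (truncDist ρ) μ t p = (0, mulRightDist p.1 (twist μ t)) := by
    intro t p
    induction t with
    | zero => simp only [map_zero, LinearMap.zero_apply]; rfl
    | add s t hs ht => simp [hs, ht]
    | tmul v f =>
      simp [crossTerm_tmul, truncVec_apply, truncDist_apply, twist_tmul, mulRightDist]
  refine LinearMap.ext fun p => ?_
  rw [h, Module.End.mul_apply, truncVec_apply, truncDist_apply, distAct_tmul, mul_zero]

/-- The action of `TV ⋊ O(G)^*` on `O(G)^* ⊕ (V ⊗ O(G)^*)`. -/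
def smashTrunc (ρ : AlgRep A V) :
    Smash ρ →ₐ[ℂ] Module.End ℂ (Distribution A × V ⊗[ℂ] Distribution A) :=
  smashLift ρ (TensorAlgebra.lift ℂ ((truncVec V).coprod (truncDist ρ))) <| by
    have hv : (TensorAlgebra.lift ℂ ((truncVec V).coprod (truncDist ρ))).toLinearMap ∘ₗ genVec A V
        = truncVec V := by
      refine LinearMap.ext fun x => ?_
      simp [genVec]
    have hd : (TensorAlgebra.lift ℂ ((truncVec V).coprod (truncDist ρ))).toLinearMap ∘ₗ genDist A V
        = truncDist ρ := by
      refine LinearMap.ext fun x => ?_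
      simp [genDist]
    have hv' := fun x => LinearMap.congr_fun hv x
    have hd' := fun x => LinearMap.congr_fun hd x
    simp only [LinearMap.comp_apply, AlgHom.toLinearMap_apply] at hv' hd'
    intro a b h
    cases h with
    | one =>
      refine (hd' 1).trans (Eq.trans ?_ (map_one _).symm)
      refine LinearMap.ext fun p => ?_
      simp [truncDist_apply, distAct_one]
    | mul μ ν =>
      rw [hd', map_mul (TensorAlgebra.lift ℂ ((truncVec V).coprod (truncDist ρ))), hd', hd']
      refine LinearMap.ext fun p => ?_
      simp [truncDist_apply, distAct_mul, mul_assoc]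
    | cross μ x => rw [map_mul, hd', hv', map_crossTerm, hv, hd, truncDist_mul_truncVec]

theorem smashTrunc_vec (ρ : AlgRep A V) (x : V) : smashTrunc ρ (smashVec ρ x) = truncVec V x := by
  simp [smashTrunc, smashVec, genVec, smashLift_mk]

theorem smashTrunc_dist (ρ : AlgRep A V) (μ : Distribution A) :
    smashTrunc ρ (smashDist ρ μ) = truncDist ρ μ := by
  simp [smashTrunc, smashDist, genDist, smashLift_mk]

/-- The action of `H_0 = SV ⋊ O(G)^*` on `O(G)^* ⊕ (V ⊗ O(G)^*)`. -/
def heckeTrunc (ρ : AlgRep A V) : Hecke ρ (0 : V →ₗ[ℂ] V →ₗ[ℂ] Distribution A) →ₐ[ℂ]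
    Module.End ℂ (Distribution A × V ⊗[ℂ] Distribution A) :=
  heckeLift ρ 0 (smashTrunc ρ) <| by
    intro a b h
    cases h with
    | comm x y =>
      simp only [map_sub, map_mul, smashTrunc_vec, smashTrunc_dist]
      refine LinearMap.ext fun p => ?_
      -- Any two vectors compose to zero, because everything of degree two is truncated away.
      simp [truncVec_apply]

theorem heckeTrunc_vec (ρ : AlgRep A V) (x : V) : heckeTrunc ρ (vec ρ 0 x) = truncVec V x := by
  simp [heckeTrunc, vec, heckeLift_mk, smashTrunc_vec]

theorem heckeTrunc_dist (ρ : AlgRep A V) (μ : Distribution A) :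
    heckeTrunc ρ (dist ρ 0 μ) = truncDist ρ μ := by
  simp [heckeTrunc, dist, heckeLift_mk, smashTrunc_dist]

/-! ### PBW in degree one and the Jacobi identity. -/

/-- The map `V ⊗ O(G)^* → H_κ`, `v ⊗ μ ↦ v · μ`. -/
def vecDist (ρ : AlgRep A V) (κ : V →ₗ[ℂ] V →ₗ[ℂ] Distribution A) :
    V ⊗[ℂ] Distribution A →ₗ[ℂ] Hecke ρ κ :=
  TensorProduct.lift ((LinearMap.mul ℂ (Hecke ρ κ)).compl₁₂ (vec ρ κ) (dist ρ κ))

theorem vecDist_tmul (ρ : AlgRep A V) (κ : V →ₗ[ℂ] V →ₗ[ℂ] Distribution A) (v : V)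
    (μ : Distribution A) : vecDist ρ κ (v ⊗ₜ μ) = vec ρ κ v * dist ρ κ μ := rfl

theorem vecDist_twist (ρ : AlgRep A V) (κ : V →ₗ[ℂ] V →ₗ[ℂ] Distribution A)
    (μ : Distribution A) (t : V ⊗[ℂ] A) :
    vecDist ρ κ (twist μ t) = crossTerm (vec ρ κ) (dist ρ κ) μ t := by
  induction t with
  | zero => simp
  | add s t hs ht => simp only [map_add, hs, ht]
  | tmul v f => rfl

/-- The degree one part of `H_0 = SV ⋊ O(G)^*` is `V ⊗ O(G)^*`. -/
theorem vecDist_zero_injective (ρ : AlgRep A V) :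
    Function.Injective (vecDist ρ (0 : V →ₗ[ℂ] V →ₗ[ℂ] Distribution A)) := by
  -- Acting on the unit distribution in degree zero recovers the tensor, so it gives a left inverse.
  have h : ∀ t : V ⊗[ℂ] Distribution A, (heckeTrunc ρ (vecDist ρ 0 t) (1, 0)).2 = t := by
    intro t
    induction t with
    | zero => simp
    | add s t hs ht => simp [hs, ht]
    | tmul v μ =>
      simp [vecDist_tmul, heckeTrunc_vec, heckeTrunc_dist, truncVec_apply, truncDist_apply]
  intro s t hst
  rw [← h s, ← h t, hst]

theorem vecDist_mem_filt (ρ : AlgRep A V) (κ : V →ₗ[ℂ] V →ₗ[ℂ] Distribution A)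
    (t : V ⊗[ℂ] Distribution A) : vecDist ρ κ t ∈ filt ρ κ 1 := by
  induction t with
  | zero => simp
  | add s t hs ht => rw [map_add]; exact add_mem hs ht
  | tmul v μ =>
    exact filt_mul ρ κ 1 0 (Submodule.mul_mem_mul (vec_mem_filt ρ κ v) (dist_mem_filt ρ κ μ))

theorem toGr_vecDist (ρ : AlgRep A V) (κ : V →ₗ[ℂ] V →ₗ[ℂ] Distribution A)
    (t : V ⊗[ℂ] Distribution A) :
    toGr ρ κ (vecDist ρ 0 t) =
      grOf (filt ρ κ) (filtLt ρ κ) 1 ⟨vecDist ρ κ t, vecDist_mem_filt ρ κ t⟩ := by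
  induction t with
  | zero =>
    rw [map_zero, map_zero, ← map_zero (grOf (filt ρ κ) (filtLt ρ κ) 1)]
    exact grOf_congr rfl _ _ (map_zero _).symm
  | add s t hs ht =>
    rw [map_add, map_add, hs, ht, ← map_add]
    exact grOf_congr rfl _ _ (map_add _ _ _).symm
  | tmul v μ =>
    rw [vecDist_tmul, map_mul, toGr_vec, toGr_dist]
    exact grOf_mul _ _

/-- Under the PBW property `V ⊗ O(G)^*` embeds in `H_κ`. -/
theorem HasPBW.vecDist_injective {ρ : AlgRep A V} {κ : V →ₗ[ℂ] V →ₗ[ℂ] Distribution A}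
    (h : HasPBW ρ κ) : Function.Injective (vecDist ρ κ) := by
  rw [injective_iff_map_eq_zero]
  intro t ht
  refine (injective_iff_map_eq_zero _).1 (vecDist_zero_injective ρ) t ?_
  -- Only the injectivity half of PBW is needed: if `v · μ` sums to zero in `H_κ`, its class in
  -- degree one of the associated graded algebra is zero.
  refine (injective_iff_map_eq_zero _).1 h.1 _ ?_
  rw [toGr_vecDist, ← map_zero (grOf (filt ρ κ) (filtLt ρ κ) 1)]
  exact grOf_congr rfl _ _ ht

theorem vecDist_twist_coact_sub (ρ : AlgRep A V) (κ : V →ₗ[ℂ] V →ₗ[ℂ] Distribution A)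
    (μ : Distribution A) (z : V) :
    vecDist ρ κ (twist μ (ρ.coact z - z ⊗ₜ 1)) =
      dist ρ κ μ * vec ρ κ z - vec ρ κ z * dist ρ κ μ := by
  rw [map_sub, map_sub, vecDist_twist, ← dist_mul_vec, twist_tmul, fsmul_one, vecDist_tmul]

/-- The Jacobi identity in `H_κ`, in the degree one part `V ⊗ O(G)^*`. -/
theorem HasPBW.jacobi {ρ : AlgRep A V} {κ : V →ₗ[ℂ] V →ₗ[ℂ] Distribution A}
    (h : HasPBW ρ κ) (x y z : V) :
    twist (κ x y) (ρ.coact z - z ⊗ₜ 1) + twist (κ y z) (ρ.coact x - x ⊗ₜ 1) +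
      twist (κ z x) (ρ.coact y - y ⊗ₜ 1) = 0 := by
  refine (injective_iff_map_eq_zero _).1 h.vecDist_injective _ ?_
  -- Once each `κ` is rewritten as a commutator, the claim is the Jacobi identity of an associative
  -- ring.
  simp only [map_add, vecDist_twist_coact_sub, ← vec_comm]
  noncomm_ring

/-- The matrix coefficient `(ℓ, (1 - g) z)`, a regular function of `g`. -/
def oneSubCoeff (ρ : AlgRep A V) (ℓ : Module.Dual ℂ V) (z : V) : A :=
  TensorProduct.lid ℂ A (ℓ.rTensor A (z ⊗ₜ 1 - ρ.coact z))

/-- This is `a ∧ κ = 0` for the row `a = (ℓ, (1 - g) ·)`: the functional `ℓ` is applied to the `V`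
factor of `HasPBW.jacobi`, with a sign from `g - 1` to `1 - g`. -/
theorem HasPBW.jacobi_coeff {ρ : AlgRep A V} {κ : V →ₗ[ℂ] V →ₗ[ℂ] Distribution A}
    (h : HasPBW ρ κ) (ℓ : Module.Dual ℂ V) (x y z : V) :
    fsmul (oneSubCoeff ρ ℓ z) (κ x y) + fsmul (oneSubCoeff ρ ℓ x) (κ y z) +
      fsmul (oneSubCoeff ρ ℓ y) (κ z x) = 0 := by
  have e : ∀ (μ : Distribution A) (t : V ⊗[ℂ] A),
      TensorProduct.lid ℂ (Distribution A) (ℓ.rTensor _ (twist μ t)) =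
        fsmul (TensorProduct.lid ℂ A (ℓ.rTensor A t)) μ := by
    intro μ t
    induction t with
    | zero => simp
    | add s t hs ht => simp only [map_add, hs, ht, LinearMap.add_apply]
    | tmul v f => simp [twist_tmul]
  have e' : ∀ (μ : Distribution A) (v : V), fsmul (oneSubCoeff ρ ℓ v) μ =
      -TensorProduct.lid ℂ (Distribution A) (ℓ.rTensor _ (twist μ (ρ.coact v - v ⊗ₜ 1))) := by
    intro μ v
    rw [e, oneSubCoeff, ← neg_sub, map_neg, map_neg, map_neg, LinearMap.neg_apply]
  have := congrArg (fun t => -TensorProduct.lid ℂ (Distribution A) (ℓ.rTensor _ t)) (h.jacobi x y z)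
  simp only [map_add, map_zero, neg_zero] at this
  rw [e', e', e', ← this]
  abel

end Module

/-! ### Linear algebra of 2-forms with values in a module. -/

section Wedge

variable {R M X : Type*} [CommRing R] [AddCommGroup M] [Module R M]

/-- `a ∧ κ = 0` and `b ∧ κ = 0` imply `(a ∧ b) ⊗ κ = κ ⊗ (a ∧ b)`. -/
theorem wedge_two_smul_comm (κ : X → X → M) (hκ : ∀ x y, κ x y = -κ y x) (a b : X → R)
    (ha : ∀ x y z, a z • κ x y + a x • κ y z + a y • κ z x = 0)
    (hb : ∀ x y z, b z • κ x y + b x • κ y z + b y • κ z x = 0) (x y z w : X) :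
    (a z * b w - a w * b z) • κ x y = (a x * b y - a y * b x) • κ z w := by
  have h1 := ha x y z
  have h2 := hb y z w
  have h3 := hb z x w
  have h4 := ha x y w
  rw [hκ w y] at h2
  rw [hκ x w, hκ w z] at h3
  linear_combination (norm := module) b w • h1 - a x • h2 - a y • h3 - b z • h4

/-- If `a ∧ κ = b ∧ κ = c ∧ κ = 0` then `a ∧ b ∧ c` annihilates `κ`. -/
theorem wedge_three_smul_eq_zero (κ : X → X → M) (hκ : ∀ x y, κ x y = -κ y x) (a : Fin 3 → X → R)
    (ha : ∀ i x y z, a i z • κ x y + a i x • κ y z + a i y • κ z x = 0) (m : Fin 3 → X) (x y : X) :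
    (Matrix.of fun i j => a j (m i)).det • κ x y = 0 := by
  have h := wedge_two_smul_comm κ hκ (a 0) (a 1) (ha 0) (ha 1) x y
  have h1 := h (m 0) (m 1)
  have h2 := h (m 1) (m 2)
  have h3 := h (m 2) (m 0)
  have h4 := ha 2 (m 0) (m 1) (m 2)
  rw [Matrix.det_fin_three]
  simp only [Matrix.of_apply]
  -- Expand the determinant along the column of `a 2`. Each 2 × 2 minor times `κ x y` becomes `(a 0
  -- ∧ a 1)(x, y)` times a value of `κ` on two of the `m i`, and what remains is `a 2 ∧ κ` at `m`,
  -- which vanishes.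
  linear_combination (norm := module) a 2 (m 2) • h1 + a 2 (m 0) • h2 + a 2 (m 1) • h3 +
    (a 0 x * a 1 y - a 0 y * a 1 x) • h4

end Wedge

/-! ### The 3 × 3 minors of `1 - g` annihilate `κ` and contain all matrix coefficients of `∧³(1 -
g)` in their ideal. -/

section Annihilator

variable {A : Type u} [CommRing A] [HopfAlgebra ℂ A] {V : Type v} [AddCommGroup V] [Module ℂ V]

variable (A) in
/-- The `O(G)`-module structure on distributions. -/
abbrev distModule : Module A (Distribution A) where
  smul f μ := fsmul f μ
  one_smul := fsmul_one
  mul_smul := fsmul_mul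
  smul_zero f := map_zero (fsmul f)
  smul_add f := map_add (fsmul f)
  add_smul f g μ := LinearMap.map_add₂ fsmul f g μ
  zero_smul μ := LinearMap.map_zero₂ fsmul μ

/-- The ideal of the functions that annihilate all values of `κ`. -/
def annIdeal (κ : V →ₗ[ℂ] V →ₗ[ℂ] Distribution A) : Ideal A where
  carrier := {f | ∀ x y, fsmul f (κ x y) = 0}
  zero_mem' x y := LinearMap.map_zero₂ fsmul _
  add_mem' hf hg x y := by rw [map_add, LinearMap.add_apply, hf, hg, add_zero]
  smul_mem' f g hg x y := by rw [smul_eq_mul, fsmul_mul, hg, map_zero]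

theorem supportedOn_of_le_annIdeal {κ : V →ₗ[ℂ] V →ₗ[ℂ] Distribution A} {I : Ideal A}
    (h : I ≤ annIdeal κ) (x y : V) : SupportedOn (κ x y) I := by
  intro f hf
  -- Evaluating `f μ` at the constant function `1` gives `μ(f)`.
  have h1 : fsmul f (κ x y) 1 = 0 := by
    rw [h hf x y]
    rfl
  rwa [fsmul_apply, mul_one] at h1

theorem HasPBW.det_mem_annIdeal {ρ : AlgRep A V} {κ : V →ₗ[ℂ] V →ₗ[ℂ] Distribution A}
    (h : HasPBW ρ κ) (hκ : IsSkew κ) (ℓ : Fin 3 → Module.Dual ℂ V) (m : Fin 3 → V) :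
    (Matrix.of fun i j => oneSubCoeff ρ (ℓ j) (m i)).det ∈ annIdeal κ := by
  intro x y
  let _ := distModule A
  exact wedge_three_smul_eq_zero (fun x y => κ x y) hκ (fun i z => oneSubCoeff ρ (ℓ i) z)
    (fun i x y z => h.jacobi_coeff (ℓ i) x y z) m x y

/-- The universal `1 - g`, as an `O(G)`-linear endomorphism of `O(G) ⊗ V`. -/
def AlgRep.oneSubUniv (ρ : AlgRep A V) : A ⊗[ℂ] V →ₗ[A] A ⊗[ℂ] V := LinearMap.id - ρ.univ

theorem oneSubUniv_tmul (ρ : AlgRep A V) (z : V) :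
    ρ.oneSubUniv (1 ⊗ₜ[ℂ] z) = TensorProduct.comm ℂ V A (z ⊗ₜ 1 - ρ.coact z) := by
  simp [AlgRep.oneSubUniv, AlgRep.univ]

theorem oneSubUniv_eq_sum {ι : Type*} [Fintype ι] (b : Module.Basis ι ℂ V) (ρ : AlgRep A V)
    (z : V) : ρ.oneSubUniv (1 ⊗ₜ[ℂ] z) =
      ∑ i, oneSubCoeff ρ (b.coord i) z • ((1 : A) ⊗ₜ[ℂ] b i) := by
  have h : ∀ t : V ⊗[ℂ] A, TensorProduct.comm ℂ V A t =
      ∑ i, TensorProduct.lid ℂ A ((b.coord i).rTensor A t) • ((1 : A) ⊗ₜ[ℂ] b i) := by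
    intro t
    induction t with
    | zero => simp
    | add s t hs ht => simp only [map_add, hs, ht, add_smul, Finset.sum_add_distrib]
    | tmul v a =>
      rw [TensorProduct.comm_tmul]
      conv_lhs => rw [← b.sum_repr v, TensorProduct.tmul_sum]
      refine Finset.sum_congr rfl fun i _ => ?_
      simp [TensorProduct.smul_tmul', TensorProduct.tmul_smul]
  rw [oneSubUniv_tmul, h]
  rfl

/-- Expanding in a basis gives sums of products of entries of `1 - g`, not minors. Averaging over
the permutations of the three arguments turns these products into determinants, and the factor `6 =
3!` is invertible over `ℂ`. -/
theorem alternating_oneSubUniv [FiniteDimensional ℂ V] (ρ : AlgRep A V) (I : Ideal A)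
    (hI : ∀ (ℓ : Fin 3 → Module.Dual ℂ V) (m : Fin 3 → V),
      (Matrix.of fun i j => oneSubCoeff ρ (ℓ j) (m i)).det ∈ I)
    (f : (A ⊗[ℂ] V) [⋀^Fin 3]→ₗ[A] A) (m : Fin 3 → V) :
    f (fun i => ρ.oneSubUniv (1 ⊗ₜ[ℂ] m i)) ∈ I := by
  let b := Module.finBasis ℂ V
  have h1 : ∀ σ : Equiv.Perm (Fin 3), f (fun i => ρ.oneSubUniv (1 ⊗ₜ[ℂ] m (σ i))) =
      ∑ r : Fin 3 → Fin (Module.finrank ℂ V),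
        (∏ j, oneSubCoeff ρ (b.coord (r j)) (m (σ j))) * f (fun j => 1 ⊗ₜ[ℂ] b (r j)) := by
    intro σ
    simp only [oneSubUniv_eq_sum b]
    rw [← AlternatingMap.coe_multilinearMap, MultilinearMap.map_sum]
    refine Finset.sum_congr rfl fun r _ => ?_
    rw [MultilinearMap.map_smul_univ, smul_eq_mul]
  have h2 : ∀ σ : Equiv.Perm (Fin 3), f (fun i => ρ.oneSubUniv (1 ⊗ₜ[ℂ] m i)) =
      Equiv.Perm.sign σ • f (fun i => ρ.oneSubUniv (1 ⊗ₜ[ℂ] m (σ i))) := by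
    intro σ
    have := f.map_perm (fun i => ρ.oneSubUniv (1 ⊗ₜ[ℂ] m i)) σ
    rw [Function.comp_def] at this
    rw [this, smul_smul, Int.units_mul_self, one_smul]
  have h3 : (6 : ℂ) • f (fun i => ρ.oneSubUniv (1 ⊗ₜ[ℂ] m i)) =
      ∑ r : Fin 3 → Fin (Module.finrank ℂ V),
        f (fun j => 1 ⊗ₜ[ℂ] b (r j)) *
          (Matrix.of fun i j => oneSubCoeff ρ (b.coord (r j)) (m i)).det := by
    calc (6 : ℂ) • f (fun i => ρ.oneSubUniv (1 ⊗ₜ[ℂ] m i))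
        = ∑ _σ : Equiv.Perm (Fin 3), f (fun i => ρ.oneSubUniv (1 ⊗ₜ[ℂ] m i)) := by
          rw [Finset.sum_const, Finset.card_univ, Fintype.card_perm, Fintype.card_fin,
            ← Nat.cast_smul_eq_nsmul ℂ]
          norm_num [Nat.factorial]
      _ = _ := by
          rw [Finset.sum_congr rfl fun σ _ => (h2 σ).trans (by rw [h1])]
          simp only [Matrix.det_apply, Finset.smul_sum, Finset.mul_sum, Matrix.of_apply]
          rw [Finset.sum_comm]
          refine Finset.sum_congr rfl fun r _ => Finset.sum_congr rfl fun σ _ => ?_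
          rw [mul_smul_comm, mul_comm]
  have h4 : (6 : ℂ) • f (fun i => ρ.oneSubUniv (1 ⊗ₜ[ℂ] m i)) ∈ I := by
    rw [h3]
    exact sum_mem fun r _ => I.mul_mem_left _ (hI _ _)
  have h5 := I.mul_mem_left (algebraMap ℂ A 6⁻¹) h4
  rwa [← Algebra.smul_def, smul_smul, inv_mul_cancel₀ (by norm_num), one_smul] at h5

theorem idealPhi_le [FiniteDimensional ℂ V] (ρ : AlgRep A V) (I : Ideal A)
    (hI : ∀ (ℓ : Fin 3 → Module.Dual ℂ V) (m : Fin 3 → V),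
      (Matrix.of fun i j => oneSubCoeff ρ (ℓ j) (m i)).det ∈ I) :
    ρ.idealPhi ≤ I := by
  refine Ideal.span_le.2 ?_
  rintro _ ⟨w, φ, rfl⟩
  -- By linearity it suffices to test matrix coefficients on wedges of vectors `1 ⊗ v`.
  have hs : Submodule.span A (Set.range fun v : V => (1 : A) ⊗ₜ[ℂ] v) = ⊤ := by
    refine eq_top_iff.2 fun t _ => ?_
    induction t with
    | zero => exact zero_mem _
    | add s t hs ht => exact add_mem (hs trivial) (ht trivial)
    | tmul a v =>
      have : a ⊗ₜ[ℂ] v = a • ((1 : A) ⊗ₜ[ℂ] v) := by simp [TensorProduct.smul_tmul']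
      rw [this]
      exact Submodule.smul_mem _ _ (Submodule.subset_span ⟨v, rfl⟩)
  have hw : w ∈ (⊤ : Submodule A (⋀[A]^3 (A ⊗[ℂ] V))) := trivial
  rw [← exteriorPower.ιMulti_span_of_span A 3 (A ⊗[ℂ] V) hs] at hw
  change φ (exteriorPower.map 3 ρ.oneSubUniv w) ∈ I
  induction hw using Submodule.span_induction with
  | zero => simp
  | add s t _ _ hs ht => rw [map_add, map_add]; exact add_mem hs ht
  | smul a t _ ht => rw [map_smul, map_smul]; exact I.smul_mem _ ht
  | mem w hw =>
    obtain ⟨n, hn, rfl⟩ := hw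
    choose m hm using fun i => hn ⟨i, rfl⟩
    rw [exteriorPower.map_apply_ιMulti]
    have := alternating_oneSubUniv ρ I hI (φ.compAlternatingMap (exteriorPower.ιMulti A 3)) m
    have hn' : n = fun i => (1 : A) ⊗ₜ[ℂ] m i := funext fun i => (hm i).symm
    rw [hn']
    exact this

/-- Under the PBW property the distributions `κ x y` are supported on `Φ`. -/
theorem HasPBW.supportedOn_idealPhi [FiniteDimensional ℂ V] {ρ : AlgRep A V}
    {κ : V →ₗ[ℂ] V →ₗ[ℂ] Distribution A} (h : HasPBW ρ κ) (hκ : IsSkew κ) (x y : V) :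
    SupportedOn (κ x y) ρ.idealPhi :=
  supportedOn_of_le_annIdeal (idealPhi_le ρ _ (h.det_mem_annIdeal hκ)) x y

end Annihilator

/-! ### From the scheme `Φ` to the set `S`. -/

section Support

variable {A : Type u} [CommRing A] [HopfAlgebra ℂ A] {V : Type v} [AddCommGroup V] [Module ℂ V]

theorem apply_oneSubCoeff (ρ : AlgRep A V) (g : A →ₐ[ℂ] ℂ) (ℓ : Module.Dual ℂ V) (z : V) :
    g (oneSubCoeff ρ ℓ z) = ℓ (z - ρ.act g z) := by
  have h : ∀ t : V ⊗[ℂ] A, g (TensorProduct.lid ℂ A (ℓ.rTensor A t)) =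
      ℓ (TensorProduct.rid ℂ V (g.toLinearMap.lTensor V t)) := by
    intro t
    induction t with
    | zero => simp
    | add s t hs ht => simp only [map_add, hs, ht]
    | tmul v a => simp [mul_comm]
  rw [oneSubCoeff, h]
  simp [AlgRep.act]

theorem liftBaseChange_oneSubUniv (ρ : AlgRep A V) (ℓ : Module.Dual ℂ V) (z : V) :
    LinearMap.liftBaseChange A (Algebra.linearMap ℂ A ∘ₗ ℓ)
      (ρ.oneSubUniv (1 ⊗ₜ[ℂ] z)) = oneSubCoeff ρ ℓ z := by
  rw [oneSubUniv_tmul, oneSubCoeff]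
  induction (z ⊗ₜ[ℂ] (1 : A) - ρ.coact z : V ⊗[ℂ] A) with
  | zero => simp
  | add s t hs ht => simp only [map_add, hs, ht]
  | tmul v a => simp [Algebra.smul_def, mul_comm]

/-- The `3 × 3` minors of `1 - g` are in the ideal of `Φ`. -/
theorem det_mem_idealPhi (ρ : AlgRep A V) (ℓ : Fin 3 → Module.Dual ℂ V) (m : Fin 3 → V) :
    (Matrix.of fun i j => oneSubCoeff ρ (ℓ j) (m i)).det ∈ ρ.idealPhi := by
  -- The form `ℓ 0 ∧ ℓ 1 ∧ ℓ 2`, extended to `O(G)`-coefficients: the minor is the matrix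
  -- coefficient of `∧³(1 - g)` that it defines on the wedge of the `1 ⊗ m i`.
  let f : (A ⊗[ℂ] V) [⋀^Fin 3]→ₗ[A] A := Matrix.detRowAlternating.compLinearMap
    (LinearMap.pi fun j => LinearMap.liftBaseChange A (Algebra.linearMap ℂ A ∘ₗ ℓ j))
  refine Ideal.subset_span ⟨exteriorPower.ιMulti A 3 fun i => 1 ⊗ₜ[ℂ] m i,
    exteriorPower.alternatingMapLinearEquiv f, ?_⟩
  change exteriorPower.alternatingMapLinearEquiv f
    (exteriorPower.map 3 ρ.oneSubUniv (exteriorPower.ιMulti A 3 fun i => 1 ⊗ₜ[ℂ] m i)) = _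
  rw [exteriorPower.map_apply_ιMulti, exteriorPower.alternatingMapLinearEquiv_apply_ιMulti]
  change Matrix.det (fun i j => LinearMap.liftBaseChange A (Algebra.linearMap ℂ A ∘ₗ ℓ j)
    (ρ.oneSubUniv (1 ⊗ₜ[ℂ] m i))) = _
  congr 1
  ext i j
  exact liftBaseChange_oneSubUniv ρ (ℓ j) (m i)

/-- The points of `Φ` are in `S`. -/
theorem mem_rankLeTwo_of_idealPhi_le (ρ : AlgRep A V) (g : A →ₐ[ℂ] ℂ)
    (hg : ρ.idealPhi ≤ RingHom.ker g) : g ∈ ρ.rankLeTwo := by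
  change LinearMap.rank _ ≤ 2
  by_contra h
  have h3 : ((3 : ℕ) : Cardinal) ≤
      Module.rank ℂ (LinearMap.range (LinearMap.id - ρ.act g : V →ₗ[ℂ] V)) := by
    have := Order.succ_le_of_lt (not_le.1 h)
    rw [← Nat.cast_ofNat, Cardinal.succ_natCast] at this
    exact_mod_cast this
  -- If the rank were at least 3, take independent vectors `w i = (1 - g)(m i)` and functionals dual
  -- to them, the coordinates of `L`. The corresponding minor lies in `I(Φ)`, yet its value at `g`
  -- is the determinant of the identity matrix.
  obtain ⟨w, hw⟩ := Module.le_rank_iff.1 h3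
  choose m hm using fun i => (w i).2
  have hw' : LinearIndependent ℂ fun i => (w i : V) :=
    hw.map' (Submodule.subtype _) (Submodule.ker_subtype _)
  obtain ⟨L, hL⟩ := LinearMap.exists_leftInverse_of_injective
    (Fintype.linearCombination ℂ fun i => (w i : V))
    (LinearMap.ker_eq_bot.2 hw'.fintypeLinearCombination_injective)
  have hLw : ∀ i, L (w i) = Pi.single i 1 := by
    intro i
    have := LinearMap.congr_fun hL (Pi.single i 1)
    simpa [Fintype.linearCombination_apply_single] using this
  have h0 := hg (det_mem_idealPhi ρ (fun j => LinearMap.proj j ∘ₗ L) m)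
  rw [RingHom.mem_ker] at h0
  have h1 : (Matrix.of fun i j => oneSubCoeff ρ (LinearMap.proj j ∘ₗ L) (m i)).map g = 1 := by
    ext i j
    rw [Matrix.map_apply, Matrix.of_apply, apply_oneSubCoeff]
    have := hm i
    rw [LinearMap.sub_apply, LinearMap.id_apply] at this
    rw [this, LinearMap.comp_apply, hLw, LinearMap.proj_apply, Pi.single_apply, Matrix.one_apply]
    simp only [eq_comm]
  have h2 := g.map_det (Matrix.of fun i j => oneSubCoeff ρ (LinearMap.proj j ∘ₗ L) (m i))
  rw [AlgHom.mapMatrix_apply, h1, Matrix.det_one] at h2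
  exact one_ne_zero (h2.symm.trans h0)

/-- The Nullstellensatz: the residue field is finite over `ℂ` by Zariski's lemma, hence equal to
`ℂ`. -/
theorem exists_point_of_isMaximal [Algebra.FiniteType ℂ A] (P : Ideal A) [P.IsMaximal] :
    ∃ g : A →ₐ[ℂ] ℂ, RingHom.ker g = P := by
  let _ : Field (A ⧸ P) := Ideal.Quotient.field P
  have : Module.Finite ℂ (A ⧸ P) := finite_of_finite_type_of_isJacobsonRing ℂ (A ⧸ P)
  let e := AlgEquiv.ofBijective (Algebra.ofId ℂ (A ⧸ P))
    (IsAlgClosed.algebraMap_bijective_of_isIntegral (k := ℂ) (K := A ⧸ P))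
  refine ⟨e.symm.toAlgHom.comp (Ideal.Quotient.mkₐ ℂ P), ?_⟩
  ext a
  simp [RingHom.mem_ker, Ideal.Quotient.eq_zero_iff_mem]

/-- In a Jacobson ring the radical is the intersection of the maximal ideals above `I(Φ)`. Each of
these is a point of `Φ`, hence of `S`. -/
theorem vanishingIdeal_rankLeTwo_le [Algebra.FiniteType ℂ A] (ρ : AlgRep A V) :
    vanishingIdeal ρ.rankLeTwo ≤ ρ.idealPhi.radical := by
  have : IsJacobsonRing A := isJacobsonRing_of_finiteType (A := ℂ)
  rw [Ideal.radical_eq_jacobson]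
  refine le_sInf ?_
  rintro P ⟨hP, hmax⟩
  obtain ⟨g, rfl⟩ := exists_point_of_isMaximal P
  exact iInf₂_le g (mem_rankLeTwo_of_idealPhi_le ρ g hP)

theorem exists_vanishingIdeal_pow_le [Algebra.FiniteType ℂ A] (ρ : AlgRep A V) :
    ∃ n : ℕ, vanishingIdeal ρ.rankLeTwo ^ n ≤ ρ.idealPhi := by
  have : IsNoetherianRing A := Algebra.FiniteType.isNoetherianRing ℂ A
  exact Ideal.exists_pow_le_of_le_radical_of_fg (vanishingIdeal_rankLeTwo_le ρ)
    (IsNoetherian.noetherian _)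

end Support

end ContHecke

end

theorem mainTheorem2 {A : Type*} [CommRing A] [HopfAlgebra ℂ A] [Algebra.FiniteType ℂ A]
    {V : Type*} [AddCommGroup V] [Module ℂ V] [FiniteDimensional ℂ V]
    (ρ : ContHecke.AlgRep A V) (κ : V →ₗ[ℂ] V →ₗ[ℂ] ContHecke.Distribution A)
    (hskew : ContHecke.IsSkew κ) (hequiv : ContHecke.IsEquivariant ρ κ)
    (hPBW : ContHecke.HasPBW ρ κ) :
    ∀ x y : V, ContHecke.SupportedOn (κ x y) ρ.idealPhi ∧
      ContHecke.SetSupportedOn (κ x y) ρ.rankLeTwo := by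
  intro x y
  have h := hPBW.supportedOn_idealPhi hskew x y
  obtain ⟨n, hn⟩ := ContHecke.exists_vanishingIdeal_pow_le ρ
  exact ⟨h, n, fun f hf => h f (hn hf)⟩
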